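/- Let $(X,\mathcal B,\mu)$ be a standard probability space and let $T$ be an automorphism of it, i.e. an invertible bimeasurable transformation of $X$ preserving $\mu$. Denote by the same letter the Koopman operator $Tf=f\circ T$ on the complex Hilbert space $L_2(X,\mu)$, and let $\Theta$ be the orthogonal projection of $L_2(X,\mu)$ onto the space of constants. Then the following five properties are equivalent. 1. $T$ is weakly mixing: there is a sequence of natural numbers $n_i\to\infty$ such that $T^{n_i}\to\Theta$ in the weak operator topology, i.e. $\langle T^{n_i}f,g\rangle\to\langle\Theta f,g\rangle$ for all $f,g\in L_2(X,\mu)$. 2. The spectrum of $T$ on the orthogonal complement of the constants is continuous, i.e. $T$ has no eigenfunction there: if $f\in L_2(X,\mu)$ is orthogonal to the constants and $Tf=zf$ for some $z\in\mathbb C$, then $f=0$. 3. The product $T\times T$ is ergodic with respect to $\mu\times\mu$. 4. $T$ is almost mixing: for all $A,B\in\mathcal B$, $$\frac1N\sum_{i=1}^N\bigl|\mu(T^iA\cap B)-\mu(A)\mu(B)\bigr|\to0,\qquad N\to\infty.$$ 5. For every ergodic automorphism $S$ of a standard probability space $(Y,\nu)$, the product $S\times T$ is ergodic with respect to $\nu\times\mu$.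 -/

import Mathlib

open MeasureTheory Filter Topology

noncomputable section

universe u

variable {X : Type u} [MeasurableSpace X] {μ : Measure X}

/-- The Koopman operator `f ↦ f ∘ T` on the complex Hilbert space `L²(X, μ)`. -/
def koopman (T : X ≃ᵐ X) (hT : MeasurePreserving T μ μ) : Lp ℂ 2 μ →L[ℂ] Lp ℂ 2 μ :=
  (Lp.compMeasurePreservingₗᵢ ℂ T hT).toContinuousLinearMap

/-- The one-dimensional subspace of (classes of) constant functions in `L²(X, μ)`. -/
def constants (μ : Measure X) [IsProbabilityMeasure μ] : Submodule ℂ (Lp ℂ 2 μ) :=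
  Submodule.span ℂ {Lp.const 2 μ (1 : ℂ)}

instance (μ : Measure X) [IsProbabilityMeasure μ] : FiniteDimensional ℂ (constants μ) := by
  unfold constants; infer_instance

/-- The orthogonal projection of `L²(X, μ)` onto the constants. -/
def Theta (μ : Measure X) [IsProbabilityMeasure μ] : Lp ℂ 2 μ →L[ℂ] Lp ℂ 2 μ :=
  (constants μ).starProjection

/-- Weak mixing: the powers of the Koopman operator converge to `Theta` in the weak operator
topology along some sequence `n i → ∞`. -/
def IsWeaklyMixing [IsProbabilityMeasure μ] (T : X ≃ᵐ X) (hT : MeasurePreserving T μ μ) : Prop :=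
  ∃ n : ℕ → ℕ, Tendsto n atTop atTop ∧
    ∀ f g : Lp ℂ 2 μ,
      Tendsto (fun i => inner ℂ g ((koopman T hT ^ n i) f)) atTop (𝓝 (inner ℂ g (Theta μ f)))

/-- Continuous spectrum on the orthocomplement of the constants: the Koopman operator has no
eigenfunction there. -/
def HasContinuousSpectrum [IsProbabilityMeasure μ] (T : X ≃ᵐ X)
    (hT : MeasurePreserving T μ μ) : Prop :=
  ∀ (z : ℂ) (f : Lp ℂ 2 μ), f ∈ (constants μ)ᗮ → koopman T hT f = z • f → f = 0

/-- Almost mixing: for all measurable `A`, `B`, the Cesàro averages of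
`|μ(Tⁱ A ∩ B) - μ(A) μ(B)|` tend to `0`. -/
def IsAlmostMixing (μ : Measure X) (T : X ≃ᵐ X) : Prop :=
  ∀ A B : Set X, MeasurableSet A → MeasurableSet B →
    Tendsto (fun N : ℕ => (1 / (N : ℝ)) *
        ∑ i ∈ Finset.Icc 1 N, |μ.real ((T^[i]) '' A ∩ B) - μ.real A * μ.real B|)
      atTop (𝓝 0)

/-- `S × T` is ergodic for every ergodic automorphism `S` of a standard probability space. -/
def HasErgodicProducts (μ : Measure X) (T : X ≃ᵐ X) : Prop :=
  ∀ (Y : Type u) [MeasurableSpace Y] [StandardBorelSpace Y] (ν : Measure Y)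
    [IsProbabilityMeasure ν] (S : Y ≃ᵐ Y),
    Ergodic S ν → Ergodic (Prod.map S T) (ν.prod μ)

end

/-! The implications proved are 1 ↔ 2 and the cycle 2 → 4 → 5 → 3 → 2. The core is
`tendsto_cesaro_norm_inner_sq`: without eigenvectors, correlations vanish in mean square. Write `U`
for the Koopman operator and let `f` be orthogonal to the constants. The mean ergodic theorem for `T
× T` makes the averages of the kernels `Uⁱf ⊗ conj (Uⁱf)` converge in `L²(μ × μ)`. Hence the
averages of the rank-one operators `h ↦ ⟨Uⁱf, h⟩ Uⁱf` converge in norm to a compact self-adjoint `A`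
commuting with `U`. If `A ≠ 0`, a finite-dimensional eigenspace of `A` contains an eigenvector of
`U`; so `A = 0`, and `⟨g, A g⟩ = 0` is the claim.

Applied to indicators, this gives 4; applied to a countable dense family, it gives 1 by a diagonal
choice of times. For 4 → 5, correlations of `S × T` on rectangles are products of a Cesàro
convergent sequence and a strongly Cesàro convergent one, and rectangles suffice
(`ergodic_of_tendsto_cesaro`). For 5 → 3, a one-point `S` shows that `T` is ergodic, and then `S =
T` is allowed. For 3 → 2, an eigenfunction `f` yields the invariant function `f ⊗ conj f`. For 1 →
2, `|⟨f, Uⁿf⟩|` is constant along an eigenfunction. -/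

/-- The Cesàro averages `N⁻¹ ∑_{i < N} c i` of a sequence `c`. -/
noncomputable def cesaro (𝕜 : Type*) [RCLike 𝕜] {E : Type*} [NormedAddCommGroup E]
    [NormedSpace 𝕜 E] (c : ℕ → E) (N : ℕ) : E :=
  (N : 𝕜)⁻¹ • ∑ i ∈ Finset.range N, c i

/-! ### Cesàro averages of sequences. -/

section Cesaro

variable {𝕜 : Type*} [RCLike 𝕜] {E : Type*} [NormedAddCommGroup E] [NormedSpace 𝕜 E]

lemma cesaro_sum {ι : Type*} (s : Finset ι) (c : ι → ℕ → E) (N : ℕ) :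
    cesaro 𝕜 (fun i => ∑ k ∈ s, c k i) N = ∑ k ∈ s, cesaro 𝕜 (c k) N := by
  simp only [cesaro]
  rw [Finset.sum_comm, Finset.smul_sum]

lemma map_cesaro {F : Type*} [NormedAddCommGroup F] [NormedSpace 𝕜 F] (φ : E →L[𝕜] F)
    (c : ℕ → E) (N : ℕ) : φ (cesaro 𝕜 c N) = cesaro 𝕜 (fun i => φ (c i)) N := by
  simp [cesaro]

lemma inner_cesaro {H : Type*} [NormedAddCommGroup H] [InnerProductSpace ℂ H] (g : H)
    (c : ℕ → H) (N : ℕ) : inner ℂ g (cesaro ℂ c N) = cesaro ℂ (fun i => inner ℂ g (c i)) N :=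
  map_cesaro (innerSL ℂ g) c N

lemma ofReal_cesaro (c : ℕ → ℝ) (N : ℕ) :
    ((cesaro ℝ c N : ℝ) : ℂ) = cesaro ℂ (fun i => (c i : ℂ)) N := by
  simp [cesaro]

lemma tendsto_cesaro_ofReal {c : ℕ → ℝ} {l : ℝ} :
    Tendsto (cesaro ℂ fun i => (c i : ℂ)) atTop (𝓝 (l : ℂ)) ↔
      Tendsto (cesaro ℝ c) atTop (𝓝 l) := by
  have : (cesaro ℂ fun i => (c i : ℂ)) = fun N => ((cesaro ℝ c N : ℝ) : ℂ) :=
    funext fun N => (ofReal_cesaro c N).symm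
  rw [this]
  exact tendsto_ofReal_iff

/-- The difference of the two averages telescopes to `(c N - c 0) / N`. -/
lemma tendsto_cesaro_succ {c : ℕ → E} {M : ℝ} (hM : ∀ i, ‖c i‖ ≤ M) {l : E} :
    Tendsto (cesaro 𝕜 fun i => c (i + 1)) atTop (𝓝 l) ↔ Tendsto (cesaro 𝕜 c) atTop (𝓝 l) := by
  have key : Tendsto (fun N => cesaro 𝕜 (fun i => c (i + 1)) N - cesaro 𝕜 c N) atTop (𝓝 0) := by
    have h0 : Tendsto (fun N : ℕ => (N : ℝ)⁻¹ * (2 * M)) atTop (𝓝 0) := by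
      simpa using (tendsto_inv_atTop_nhds_zero_nat (𝕜 := ℝ)).mul_const (2 * M)
    refine squeeze_zero_norm (fun N => ?_) h0
    have : cesaro 𝕜 (fun i => c (i + 1)) N - cesaro 𝕜 c N = (N : 𝕜)⁻¹ • (c N - c 0) := by
      rw [cesaro, cesaro, ← smul_sub, ← Finset.sum_sub_distrib, Finset.sum_range_sub]
    rw [this, norm_smul, norm_inv, RCLike.norm_natCast]
    gcongr
    calc ‖c N - c 0‖ ≤ ‖c N‖ + ‖c 0‖ := norm_sub_le _ _
      _ ≤ 2 * M := by linarith [hM N, hM 0]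
  constructor
  · intro h; simpa using h.sub key
  · intro h; simpa using h.add key

lemma one_div_mul_sum_Icc (c : ℕ → ℝ) (N : ℕ) :
    (1 / (N : ℝ)) * ∑ i ∈ Finset.Icc 1 N, c i = cesaro ℝ (fun i => c (i + 1)) N := by
  rw [cesaro, smul_eq_mul, one_div, Finset.range_eq_Ico, Finset.sum_Ico_add' c 0 N 1]
  rfl

/-- Cauchy–Schwarz: the square of an average is at most the average of the squares. -/
lemma tendsto_cesaro_abs_of_sq {c : ℕ → ℝ}
    (h : Tendsto (cesaro ℝ fun i => c i ^ 2) atTop (𝓝 0)) :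
    Tendsto (cesaro ℝ fun i => |c i|) atTop (𝓝 0) := by
  have h1 : Tendsto (fun N => √(cesaro ℝ (fun i => c i ^ 2) N)) atTop (𝓝 0) := by
    simpa using h.sqrt
  refine squeeze_zero (fun N => ?_) (fun N => Real.le_sqrt_of_sq_le ?_) h1
  · exact smul_nonneg (by positivity) (Finset.sum_nonneg fun i _ => abs_nonneg _)
  · rcases Nat.eq_zero_or_pos N with rfl | hN
    · simp [cesaro]
    have := sq_sum_le_card_mul_sum_sq (s := Finset.range N) (f := fun i => |c i|)
    simp only [Finset.card_range, sq_abs] at this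
    simp only [cesaro, smul_eq_mul, mul_pow]
    have hN' : (0 : ℝ) < N := by exact_mod_cast hN
    calc ((N : ℝ)⁻¹) ^ 2 * (∑ i ∈ Finset.range N, |c i|) ^ 2
        ≤ ((N : ℝ)⁻¹) ^ 2 * (N * ∑ i ∈ Finset.range N, c i ^ 2) := by gcongr
      _ = _ := by field_simp

/-- Split `b i = β + (b i - β)`: boundedness of `a` lets the absolute averages control the second
term. Plain Cesàro convergence of `b` would not suffice. -/
lemma tendsto_cesaro_mul {a b : ℕ → ℝ} {α β : ℝ} (ha1 : ∀ i, |a i| ≤ 1)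
    (ha : Tendsto (cesaro ℝ a) atTop (𝓝 α))
    (hb : Tendsto (cesaro ℝ fun i => |b i - β|) atTop (𝓝 0)) :
    Tendsto (cesaro ℝ fun i => a i * b i) atTop (𝓝 (α * β)) := by
  have h1 : Tendsto (cesaro ℝ fun i => a i * (b i - β)) atTop (𝓝 0) := by
    refine squeeze_zero_norm (fun N => ?_) hb
    simp only [cesaro, smul_eq_mul, norm_mul, norm_inv, Real.norm_natCast]
    gcongr
    refine (norm_sum_le _ _).trans (Finset.sum_le_sum fun i _ => ?_)
    rw [norm_mul, Real.norm_eq_abs, Real.norm_eq_abs]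
    exact mul_le_of_le_one_left (abs_nonneg _) (ha1 i)
  have h2 := h1.add (ha.mul_const β)
  rw [zero_add] at h2
  refine h2.congr fun N => ?_
  simp only [cesaro, smul_eq_mul, mul_assoc, Finset.sum_mul]
  rw [← mul_add, ← Finset.sum_add_distrib]
  congr 1
  exact Finset.sum_congr rfl fun i _ => by ring

lemma exists_lt_of_tendsto_cesaro_zero {c : ℕ → ℝ} (hc : ∀ i, 0 ≤ c i)
    (h : Tendsto (cesaro ℝ c) atTop (𝓝 0)) {ε : ℝ} (hε : 0 < ε) (n₀ : ℕ) :
    ∃ n, n₀ ≤ n ∧ c n < ε := by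
  by_contra! hcon
  -- If `c ≥ ε` from `n₀` on, the average is at least `(1 - n₀ / N) ε`, which exceeds `ε / 2` once
  -- `N > 2 n₀`.
  obtain ⟨N, hN, hlt⟩ := ((eventually_ge_atTop (2 * n₀ + 1)).and
    (h.eventually (gt_mem_nhds (half_pos hε)))).exists
  have hN' : (0 : ℝ) < N := by exact_mod_cast (by omega : 0 < N)
  have h1 : ((N : ℝ) - n₀) * ε ≤ ∑ i ∈ Finset.range N, c i := by
    calc ((N : ℝ) - n₀) * ε = ∑ i ∈ Finset.Ico n₀ N, ε := by
          simp [Nat.cast_sub (by omega : n₀ ≤ N)]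
      _ ≤ ∑ i ∈ Finset.Ico n₀ N, c i :=
          Finset.sum_le_sum fun i hi => hcon i (Finset.mem_Ico.1 hi).1
      _ ≤ _ := Finset.sum_le_sum_of_subset_of_nonneg
          (fun i hi => Finset.mem_range.2 (Finset.mem_Ico.1 hi).2) fun i _ _ => hc i
  rw [cesaro, smul_eq_mul, inv_mul_lt_iff₀ hN'] at hlt
  have h2 : (2 * n₀ + 1 : ℝ) ≤ N := by exact_mod_cast hN
  nlinarith

end Cesaro

/-! ### Composition operators, the mean ergodic theorem and ergodicity criteria. -/

/-- The composition operator `f ↦ f ∘ S` on `L²` for a measure-preserving map `S`. -/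
noncomputable def compL2 {Z : Type*} [MeasurableSpace Z] {ρ : Measure Z} (S : Z → Z)
    (hS : MeasurePreserving S ρ ρ) : Lp ℂ 2 ρ →L[ℂ] Lp ℂ 2 ρ :=
  (Lp.compMeasurePreservingₗᵢ ℂ S hS).toContinuousLinearMap

section CompL2

variable {Z : Type*} [MeasurableSpace Z] {ρ : Measure Z} {S : Z → Z}
  (hS : MeasurePreserving S ρ ρ)

lemma compL2_apply (f : Lp ℂ 2 ρ) : compL2 S hS f = Lp.compMeasurePreserving S hS f := rfl

lemma compL2_coeFn (f : Lp ℂ 2 ρ) : compL2 S hS f =ᵐ[ρ] f ∘ S :=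
  Lp.coeFn_compMeasurePreserving f hS

lemma inner_compL2 (f g : Lp ℂ 2 ρ) :
    inner ℂ (compL2 S hS f) (compL2 S hS g) = inner ℂ f g :=
  (Lp.compMeasurePreservingₗᵢ ℂ S hS).inner_map_map f g

lemma norm_compL2_apply (f : Lp ℂ 2 ρ) : ‖compL2 S hS f‖ = ‖f‖ :=
  (Lp.compMeasurePreservingₗᵢ ℂ S hS).norm_map f

lemma norm_compL2_le : ‖compL2 S hS‖ ≤ 1 :=
  ContinuousLinearMap.opNorm_le_bound _ zero_le_one fun f => by
    rw [norm_compL2_apply, one_mul]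

lemma norm_iterate_compL2 (i : ℕ) (f : Lp ℂ 2 ρ) : ‖(compL2 S hS)^[i] f‖ = ‖f‖ := by
  induction i with
  | zero => rfl
  | succ i ih => rw [Function.iterate_succ_apply', norm_compL2_apply, ih]

lemma iterate_compL2_eq (i : ℕ) :
    (compL2 S hS)^[i] = compL2 S^[i] (hS.iterate i) :=
  Lp.compMeasurePreserving_iterate (E := ℂ) (p := 2) hS i

lemma iterate_compL2_indicator [IsFiniteMeasure ρ] {C : Set Z} (hC : MeasurableSet C) (i : ℕ) :
    (compL2 S hS)^[i] (indicatorConstLp 2 hC (measure_ne_top ρ C) (1 : ℂ)) =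
      indicatorConstLp 2 ((hS.iterate i).measurable hC) (measure_ne_top ρ _) (1 : ℂ) := by
  rw [iterate_compL2_eq, compL2_apply, Lp.indicatorConstLp_compMeasurePreserving]

lemma inner_indicator_iterate_compL2 [IsFiniteMeasure ρ] {A C : Set Z} (hA : MeasurableSet A)
    (hC : MeasurableSet C) (i : ℕ) :
    inner ℂ (indicatorConstLp 2 hA (measure_ne_top ρ A) (1 : ℂ))
      ((compL2 S hS)^[i] (indicatorConstLp 2 hC (measure_ne_top ρ C) (1 : ℂ))) =
      (ρ.real (A ∩ S^[i] ⁻¹' C) : ℂ) := by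
  rw [iterate_compL2_indicator, L2.inner_indicatorConstLp_one_indicatorConstLp_one]
  rfl

/-- The mean ergodic theorem for the composition operator. -/
lemma exists_tendsto_cesaro_compL2 (f : Lp ℂ 2 ρ) :
    ∃ h, compL2 S hS h = h ∧
      Tendsto (cesaro ℂ fun i => (compL2 S hS)^[i] f) atTop (𝓝 h) := by
  have key := (compL2 S hS).tendsto_birkhoffAverage_orthogonalProjection (norm_compL2_le hS) f
  have hfix : ∀ y : (compL2 S hS).eqLocus (1 : Lp ℂ 2 ρ →L[ℂ] Lp ℂ 2 ρ), compL2 S hS y = y :=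
    fun y => y.2
  exact ⟨_, hfix _, key⟩

lemma exists_ae_eq_const_of_compL2_eq (hE : Ergodic S ρ) {h : Lp ℂ 2 ρ}
    (hh : compL2 S hS h = h) : ∃ c : ℂ, h =ᵐ[ρ] fun _ => c := by
  refine hE.ae_eq_const_of_ae_eq_comp_ae (Lp.aestronglyMeasurable h) ?_
  exact (compL2_coeFn hS h).symm.trans (by rw [hh])

lemma tendsto_cesaro_measure_inter [IsFiniteMeasure ρ] {A C : Set Z} (hA : MeasurableSet A)
    {h : Lp ℂ 2 ρ} (hC : MeasurableSet C)
    (hh : Tendsto (cesaro ℂ fun i =>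
      (compL2 S hS)^[i] (indicatorConstLp 2 hC (measure_ne_top ρ C) (1 : ℂ))) atTop (𝓝 h)) :
    Tendsto (cesaro ℂ fun i => (ρ.real (A ∩ S^[i] ⁻¹' C) : ℂ)) atTop (𝓝 (∫ x in A, h x ∂ρ)) := by
  rw [← L2.inner_indicatorConstLp_one hA (measure_ne_top ρ A)]
  refine ((innerSL ℂ (indicatorConstLp 2 hA (measure_ne_top ρ A) (1 : ℂ))).continuous.tendsto
    h).comp hh |>.congr fun N => ?_
  simp only [Function.comp_apply, innerSL_apply_apply, inner_cesaro,
    inner_indicator_iterate_compL2 hS hA hC]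

lemma tendsto_cesaro_const {E : Type*} [NormedAddCommGroup E] [NormedSpace ℂ E] (c : E) :
    Tendsto (cesaro ℂ fun _ => c) atTop (𝓝 c) := by
  refine tendsto_const_nhds.congr' ?_
  filter_upwards [eventually_gt_atTop 0] with N hN
  have : (N : ℂ) ≠ 0 := by exact_mod_cast hN.ne'
  simp [cesaro, ← Nat.cast_smul_eq_nsmul ℂ, smul_smul, this]

/-- Ergodic maps are mixing on average. -/
lemma tendsto_cesaro_of_ergodic [IsProbabilityMeasure ρ] (hE : Ergodic S ρ) {A C : Set Z}
    (hA : MeasurableSet A) (hC : MeasurableSet C) :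
    Tendsto (cesaro ℝ fun i => ρ.real (A ∩ S^[i] ⁻¹' C)) atTop (𝓝 (ρ.real A * ρ.real C)) := by
  have hS := hE.toMeasurePreserving
  obtain ⟨h, hfix, hlim⟩ := exists_tendsto_cesaro_compL2 hS
    (indicatorConstLp 2 hC (measure_ne_top ρ C) (1 : ℂ))
  obtain ⟨c, hc⟩ := exists_ae_eq_const_of_compL2_eq hS hE hfix
  have hint : ∀ B : Set Z, ∫ x in B, h x ∂ρ = ρ.real B * c := fun B => by
    rw [integral_congr_ae (ae_restrict_of_ae hc)]; simp
  -- Testing against the whole space identifies the constant: `c = ρ(C)`.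
  have h1 := tendsto_cesaro_measure_inter hS MeasurableSet.univ hC hlim
  have h2 := tendsto_cesaro_measure_inter hS hA hC hlim
  simp only [Set.univ_inter, (hS.iterate _).measureReal_preimage hC.nullMeasurableSet, hint,
    probReal_univ, Complex.ofReal_one, one_mul] at h1
  rw [hint, ← tendsto_nhds_unique (tendsto_cesaro_const _) h1, ← Complex.ofReal_mul] at h2
  exact tendsto_cesaro_ofReal.1 h2

/-- A map that is mixing on average on a generating π-system is ergodic. -/
lemma ergodic_of_tendsto_cesaro [IsProbabilityMeasure ρ] (hS : MeasurePreserving S ρ ρ)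
    {𝒞 : Set (Set Z)} (hgen : ‹MeasurableSpace Z› = MeasurableSpace.generateFrom 𝒞)
    (hpi : IsPiSystem 𝒞)
    (h : ∀ A ∈ 𝒞, ∀ C ∈ 𝒞,
      Tendsto (cesaro ℝ fun i => ρ.real (A ∩ S^[i] ⁻¹' C)) atTop (𝓝 (ρ.real A * ρ.real C))) :
    Ergodic S ρ := by
  have hmeas : ∀ A ∈ 𝒞, MeasurableSet A := fun A hA => by
    rw [hgen]; exact MeasurableSpace.measurableSet_generateFrom hA
  refine ⟨hS, ⟨fun E hE hinv => ?_⟩⟩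
  have key : ∀ C ∈ 𝒞, ρ.real (E ∩ C) = ρ.real E * ρ.real C := by
    intro C hC𝒞
    have hC := hmeas C hC𝒞
    obtain ⟨u, hfix, hlim⟩ := exists_tendsto_cesaro_compL2 hS
      (indicatorConstLp 2 hC (measure_ne_top ρ C) (1 : ℂ))
    have hu : Integrable u ρ := (Lp.memLp u).integrable one_le_two
    -- The ergodic limit `u` of the indicator of `C` has the integrals of the constant `ρ(C)` over
    -- the π-system, hence over every measurable set, in particular over `E`.
    have hall : ∀ A, MeasurableSet A → ∫ x in A, u x ∂ρ = ((ρ.real A * ρ.real C : ℝ) : ℂ) := by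
      have htot : ∫ x, u x ∂ρ = (ρ.real C : ℂ) := by
        have h1 := tendsto_cesaro_measure_inter hS MeasurableSet.univ hC hlim
        simp only [Set.univ_inter, (hS.iterate _).measureReal_preimage hC.nullMeasurableSet,
          Measure.restrict_univ] at h1
        exact tendsto_nhds_unique h1 (tendsto_cesaro_const _)
      refine MeasurableSpace.induction_on_inter hgen hpi (by simp) ?_ ?_ ?_
      · intro A hA
        exact tendsto_nhds_unique (tendsto_cesaro_measure_inter hS (hmeas A hA) hC hlim)
          (tendsto_cesaro_ofReal.2 (h A hA C hC𝒞))
      · intro A hA ih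
        have := integral_add_compl hA hu
        rw [ih, htot] at this
        rw [probReal_compl_eq_one_sub hA]
        push_cast at this ⊢
        linear_combination this
      · intro s hd hs ih
        have h1 := hasSum_integral_iUnion hs hd hu.integrableOn
        simp only [ih] at h1
        have h2 : HasSum (fun i => ρ.real (s i)) (ρ.real (⋃ i, s i)) := by
          have := hasSum_integral_iUnion (f := fun _ => (1 : ℝ)) (μ := ρ) hs hd
            (integrable_const _).integrableOn
          simpa using this
        exact h1.unique (Complex.hasSum_ofReal.2 (h2.mul_right _))
    have h3 := tendsto_cesaro_measure_inter hS hE hC hlim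
    -- For invariant `E` the averaged sequence is constant.
    have h4 : ∀ i, ρ.real (E ∩ S^[i] ⁻¹' C) = ρ.real (E ∩ C) := fun i => by
      have hEi : S^[i] ⁻¹' E = E := by
        induction i with
        | zero => rfl
        | succ i ih => rw [Function.iterate_succ, Set.preimage_comp, ih, hinv]
      rw [← (hS.iterate i).measureReal_preimage (hE.inter hC).nullMeasurableSet,
        Set.preimage_inter, hEi]
    simp only [h4] at h3
    have := tendsto_nhds_unique (tendsto_cesaro_const _) h3
    rw [hall E hE] at this
    exact_mod_cast this
  -- `E` is independent of the π-system, hence of every measurable set, including itself: `ρ E = (ρ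
  -- E)²`.
  have heq : ρ.restrict E = ρ E • ρ := by
    refine ext_of_generate_finite 𝒞 hgen hpi (fun C hC => ?_) (by simp)
    rw [Measure.restrict_apply (hmeas C hC), Measure.smul_apply, smul_eq_mul, Set.inter_comm,
      ← ENNReal.toReal_eq_toReal_iff' (by finiteness) (by finiteness), ENNReal.toReal_mul]
    exact key C hC
  have hsq : ρ E = ρ E * ρ E := by
    simpa [Measure.restrict_apply hE] using congrArg (fun m : Measure Z => m E) heq
  rw [eventuallyConst_set']
  by_cases h0 : ρ E = 0
  · exact Or.inl (ae_eq_empty.2 h0)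
  · right
    have h1 : ρ E = 1 := by
      have := (ENNReal.mul_eq_left (a := ρ E) h0 (measure_ne_top _ _)).1 hsq.symm
      exact this
    exact ae_eq_univ.2 ((prob_compl_eq_zero_iff hE).2 h1)

end CompL2

/-! ### Kernels in `L²(μ × μ)`; the conjugate makes `tensor f f` the kernel of `h ↦ ⟨f, h⟩ f`. -/

section Tensor

variable {X : Type*} [MeasurableSpace X] {μ : Measure X}

lemma memLp_tensor [SFinite μ] (f g : Lp ℂ 2 μ) :
    MemLp (fun p : X × X => f p.1 * starRingEnd ℂ (g p.2)) 2 (μ.prod μ) := by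
  have hm : AEStronglyMeasurable (fun p : X × X => f p.1 * starRingEnd ℂ (g p.2)) (μ.prod μ) :=
    (Lp.aestronglyMeasurable f).comp_fst.mul
      (Complex.continuous_conj.comp_aestronglyMeasurable (Lp.aestronglyMeasurable g).comp_snd)
  rw [memLp_two_iff_integrable_sq_norm hm]
  have := ((memLp_two_iff_integrable_sq_norm (Lp.aestronglyMeasurable f)).1
    (Lp.memLp f)).mul_prod ((memLp_two_iff_integrable_sq_norm (Lp.aestronglyMeasurable g)).1
    (Lp.memLp g))
  simpa [mul_pow] using this

/-- The class in `L²(μ × μ)` of the kernel `(x, y) ↦ f x * conj (g y)`. -/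
noncomputable def tensor [SFinite μ] (f g : Lp ℂ 2 μ) : Lp ℂ 2 (μ.prod μ) :=
  (memLp_tensor f g).toLp _

lemma tensor_coeFn [SFinite μ] (f g : Lp ℂ 2 μ) :
    tensor f g =ᵐ[μ.prod μ] fun p => f p.1 * starRingEnd ℂ (g p.2) :=
  (memLp_tensor f g).coeFn_toLp

lemma inner_tensor [SFinite μ] (f g f' g' : Lp ℂ 2 μ) :
    inner ℂ (tensor f g) (tensor f' g') = inner ℂ f f' * inner ℂ g' g := by
  rw [L2.inner_def, L2.inner_def, L2.inner_def, ← integral_prod_mul]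
  refine integral_congr_ae ?_
  filter_upwards [tensor_coeFn f g, tensor_coeFn f' g'] with p h1 h2
  simp only [h1, h2, RCLike.inner_apply, map_mul, Complex.conj_conj]
  ring

lemma norm_tensor [SFinite μ] (f g : Lp ℂ 2 μ) : ‖tensor f g‖ = ‖f‖ * ‖g‖ := by
  have h := inner_tensor f g f g
  simp only [inner_self_eq_norm_sq_to_K] at h
  have h' : ‖tensor f g‖ ^ 2 = (‖f‖ * ‖g‖) ^ 2 := by rw [mul_pow]; exact_mod_cast h
  exact (pow_left_inj₀ (norm_nonneg _) (by positivity) two_ne_zero).1 h'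

lemma compL2_tensor [SFinite μ] {S : X → X} (hS : MeasurePreserving S μ μ) (f g : Lp ℂ 2 μ) :
    compL2 (Prod.map S S) (hS.prod hS) (tensor f g) = tensor (compL2 S hS f) (compL2 S hS g) := by
  refine Lp.ext ?_
  have h1 := (hS.prod hS).quasiMeasurePreserving.ae_eq_comp (tensor_coeFn f g)
  have h2 := (Measure.quasiMeasurePreserving_fst (μ := μ) (ν := μ)).ae_eq_comp (compL2_coeFn hS f)
  have h3 := (Measure.quasiMeasurePreserving_snd (μ := μ) (ν := μ)).ae_eq_comp (compL2_coeFn hS g)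
  filter_upwards [compL2_coeFn (hS.prod hS) (tensor f g), h1, h2, h3,
    tensor_coeFn (compL2 S hS f) (compL2 S hS g)] with p a1 a2 a3 a4 a5
  simp only [Function.comp_apply, Prod.map_fst, Prod.map_snd] at *
  rw [a1, a2, a5, a3, a4]

lemma iterate_compL2_tensor [SFinite μ] {S : X → X} (hS : MeasurePreserving S μ μ)
    (f g : Lp ℂ 2 μ) (i : ℕ) :
    (compL2 (Prod.map S S) (hS.prod hS))^[i] (tensor f g) =
      tensor ((compL2 S hS)^[i] f) ((compL2 S hS)^[i] g) := by
  induction i with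
  | zero => rfl
  | succ i ih =>
    simp only [Function.iterate_succ_apply', ih]
    exact compL2_tensor hS _ _

end Tensor

/-! ### Eigenvectors from commuting compact operators. -/

section Eigenvector

variable {H : Type*} [NormedAddCommGroup H] [InnerProductSpace ℂ H] [CompleteSpace H]

/-- An operator that commutes with a nonzero compact self-adjoint operator has an eigenvector
in the range of the latter. -/
lemma exists_eigenvector_of_commute_compact {A U : H →L[ℂ] H} (hA : IsCompactOperator A)
    (hsymm : A.IsSymmetric) (hne : A ≠ 0) (hcomm : ∀ x, A (U x) = U (A x)) :
    ∃ (z : ℂ) (v : H), v ≠ 0 ∧ U v = z • v ∧ v ∈ A.range := by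
  have h := mt (ContinuousLinearMap.eq_zero_of_forall_hasEigenvalue_eq_zero hA hsymm).1 hne
  push Not at h
  obtain ⟨a, ha, ha0⟩ := h
  have := ContinuousLinearMap.finite_dimensional_eigenspace hA a ha0
  set V := Module.End.eigenspace A.toLinearMap a with hV
  have hmem : ∀ x, x ∈ V ↔ A x = a • x := fun x => Module.End.mem_eigenspace_iff
  -- `U` preserves the finite-dimensional eigenspace `V`, so it has an eigenvector there; division
  -- by `a ≠ 0` puts it in the range of `A`.
  have hUV : ∀ x ∈ V, U.toLinearMap x ∈ V := fun x hx => by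
    rw [hmem] at hx ⊢
    simp only [ContinuousLinearMap.coe_coe]
    rw [hcomm, hx, map_smul]
  have : Nontrivial V := Submodule.nontrivial_iff_ne_bot.2 ha
  obtain ⟨z, hz⟩ := Module.End.exists_eigenvalue (U.toLinearMap.restrict hUV)
  obtain ⟨v, hv, hv0⟩ := hz.exists_hasEigenvector
  rw [Module.End.mem_eigenspace_iff] at hv
  refine ⟨z, v, fun h => hv0 (Subtype.ext h), congrArg Subtype.val hv, a⁻¹ • v.1, ?_⟩
  have := (hmem v).1 v.2
  simp [this, smul_smul, ha0]

end Eigenvector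

/-! ### Averages of rank-one operators along an orbit and decay of correlations. -/

section RankOne

open InnerProductSpace

variable {X : Type*} [MeasurableSpace X] {μ : Measure X}

lemma isCompactOperator_rankOne {H : Type*} [NormedAddCommGroup H] [InnerProductSpace ℂ H]
    (x y : H) : IsCompactOperator (rankOne ℂ x y) := by
  have h : IsCompactOperator (innerSL ℂ y) := by
    refine ⟨Metric.closedBall 0 1, isCompact_closedBall _ _, ?_⟩
    exact (innerSL ℂ y).continuous.continuousAt (by
      simpa using Metric.closedBall_mem_nhds (0 : ℂ) one_pos)
  exact h.clm_comp (.toSpanSingleton ℂ x)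

lemma inner_cesaro_rankOne [SFinite μ] (u : ℕ → Lp ℂ 2 μ) (g h : Lp ℂ 2 μ) (N : ℕ) :
    inner ℂ g (cesaro ℂ (fun i => rankOne ℂ (u i) (u i)) N h) =
      inner ℂ (tensor g h) (cesaro ℂ (fun i => tensor (u i) (u i)) N) := by
  have h1 : cesaro ℂ (fun i => rankOne ℂ (u i) (u i)) N h =
      cesaro ℂ (fun i => rankOne ℂ (u i) (u i) h) N := by simp [cesaro]
  rw [h1, inner_cesaro, inner_cesaro]
  simp only [inner_right_rankOne_apply, inner_tensor]

/-- The averages of the rank-one operators `u i ⊗ (u i)*` converge in operator norm as soon as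
the averages of the corresponding kernels converge in `L²`. -/
lemma exists_tendsto_cesaro_rankOne [SFinite μ] {u : ℕ → Lp ℂ 2 μ} {F : Lp ℂ 2 (μ.prod μ)}
    (hF : Tendsto (cesaro ℂ fun i => tensor (u i) (u i)) atTop (𝓝 F)) :
    ∃ A, Tendsto (cesaro ℂ fun i => rankOne ℂ (u i) (u i)) atTop (𝓝 A) := by
  refine cauchySeq_tendsto_of_complete ?_
  have hC := hF.cauchySeq
  rw [Metric.cauchySeq_iff] at hC ⊢
  intro ε hε
  obtain ⟨N₀, hN₀⟩ := hC ε hε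
  refine ⟨N₀, fun m hm n hn => lt_of_le_of_lt ?_ (hN₀ m hm n hn)⟩
  rw [dist_eq_norm, dist_eq_norm]
  refine ContinuousLinearMap.opNorm_le_bound _ (norm_nonneg _) fun h => ?_
  set B := cesaro ℂ (fun i => rankOne ℂ (u i) (u i)) m - cesaro ℂ (fun i => rankOne ℂ (u i) (u i)) n
  set D := cesaro ℂ (fun i => tensor (u i) (u i)) m - cesaro ℂ (fun i => tensor (u i) (u i)) n
  -- The operator norm is at most the Hilbert–Schmidt norm: `B` has kernel `D`, tested here at `B h
  -- ⊗ conj h`.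
  have key : inner ℂ (B h) (B h) = inner ℂ (tensor (B h) h) D := by
    simp only [D]
    rw [inner_sub_right, ← inner_cesaro_rankOne, ← inner_cesaro_rankOne, ← inner_sub_right]
    rfl
  have h2 : ‖B h‖ * ‖B h‖ ≤ ‖B h‖ * ‖h‖ * ‖D‖ := by
    rw [← norm_tensor (B h) h]
    refine le_trans (le_of_eq ?_) (norm_inner_le_norm (𝕜 := ℂ) _ _)
    rw [← key, inner_self_eq_norm_sq_to_K]
    simp [sq]
  rcases (norm_nonneg (B h)).eq_or_lt with h0 | h0
  · rw [← h0]; positivity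
  · refine le_of_mul_le_mul_left ?_ h0
    linarith

variable {S : X → X} (hS : MeasurePreserving S μ μ)

/-- If a unitary composition operator has no eigenvector in a closed subspace containing the orbit
of `f`, then the correlations of `f` with any `g` tend to zero in mean square. -/
lemma tendsto_cesaro_norm_inner_sq [SFinite μ] (hsurj : Function.Surjective (compL2 S hS))
    (K : Submodule ℂ (Lp ℂ 2 μ)) (hK : IsClosed (K : Set (Lp ℂ 2 μ)))
    (hKU : ∀ x ∈ K, compL2 S hS x ∈ K)
    (hspec : ∀ (z : ℂ), ∀ x ∈ K, compL2 S hS x = z • x → x = 0)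
    {f : Lp ℂ 2 μ} (hf : f ∈ K) (g : Lp ℂ 2 μ) :
    Tendsto (cesaro ℝ fun i => ‖inner ℂ g ((compL2 S hS)^[i] f)‖ ^ 2) atTop (𝓝 0) := by
  set U := compL2 S hS with hU
  set u : ℕ → Lp ℂ 2 μ := fun i => U^[i] f with hu
  have huK : ∀ i, u i ∈ K := fun i => by
    induction i with
    | zero => exact hf
    | succ i ih => simp only [hu, Function.iterate_succ_apply'] at ih ⊢; exact hKU _ ih
  obtain ⟨F, -, hF⟩ := exists_tendsto_cesaro_compL2 (hS.prod hS) (tensor f f)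
  replace hF : Tendsto (cesaro ℂ fun i => tensor (u i) (u i)) atTop (𝓝 F) := by
    convert hF using 2
    funext i
    exact (iterate_compL2_tensor hS f f i).symm
  obtain ⟨A, hA⟩ := exists_tendsto_cesaro_rankOne hF
  have happ : ∀ h, Tendsto (fun N => cesaro ℂ (fun i => rankOne ℂ (u i) (u i)) N h)
      atTop (𝓝 (A h)) := fun h =>
    ((ContinuousLinearMap.apply ℂ (Lp ℂ 2 μ) h).continuous.tendsto A).comp hA
  have hinner : ∀ g h, Tendsto (cesaro ℂ fun i => inner ℂ g (u i) * inner ℂ (u i) h)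
      atTop (𝓝 (inner ℂ g (A h))) := fun g h => by
    refine (((innerSL ℂ g).continuous.tendsto _).comp (happ h)).congr fun N => ?_
    simp only [Function.comp_apply, innerSL_apply_apply, inner_cesaro_rankOne, inner_cesaro,
      inner_tensor]
  have hcompact : IsCompactOperator A := by
    refine isCompactOperator_of_tendsto hA (Eventually.of_forall fun N => ?_)
    exact (compactOperator (RingHom.id ℂ) (Lp ℂ 2 μ) (Lp ℂ 2 μ)).smul_mem _
      (Submodule.sum_mem _ fun i _ => isCompactOperator_rankOne _ _)
  have hsymm : A.IsSymmetric := fun x y => by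
    change inner ℂ (A x) y = inner ℂ x (A y)
    have h1 := (Complex.continuous_conj.tendsto _).comp (hinner y x)
    rw [inner_conj_symm] at h1
    refine tendsto_nhds_unique h1 ((hinner x y).congr fun N => ?_)
    simp [cesaro, mul_comm]
  -- Moving `U` off both arguments shifts the orbit index by one, which does not change the Cesàro
  -- limit.
  have hcomm : ∀ x, A (U x) = U (A x) := fun x => by
    refine ext_inner_left ℂ fun y => ?_
    obtain ⟨y, rfl⟩ := hsurj y
    rw [inner_compL2]
    have h1 := hinner (U y) (U x)
    rw [← tendsto_cesaro_succ (M := ‖U y‖ * ‖f‖ * (‖f‖ * ‖U x‖)) (fun i => ?_)] at h1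
    · simp only [hu, Function.iterate_succ_apply', hU, inner_compL2] at h1
      exact tendsto_nhds_unique h1 (hinner y x)
    · rw [norm_mul]
      have : ‖u i‖ = ‖f‖ := norm_iterate_compL2 hS i f
      gcongr
      · exact this ▸ norm_inner_le_norm _ _
      · exact this ▸ norm_inner_le_norm _ _
  -- An eigenvector found in the range of `A` thus lies in `K`, where `hspec` excludes it.
  have hrange : ∀ x, A x ∈ K := fun x => by
    refine hK.mem_of_tendsto (happ x) (Eventually.of_forall fun N => ?_)
    simp only [cesaro, _root_.smul_apply, _root_.sum_apply,
      rankOne_apply]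
    exact K.smul_mem _ (K.sum_mem fun i _ => K.smul_mem _ (huK i))
  have hzero : A = 0 := by
    by_contra hne
    obtain ⟨z, v, hv0, hv, x, hx⟩ := exists_eigenvector_of_commute_compact hcompact hsymm hne hcomm
    exact hv0 (hspec z v (hx ▸ hrange x) hv)
  have hfin := hinner g g
  rw [hzero, _root_.zero_apply, inner_zero_right] at hfin
  refine tendsto_cesaro_ofReal.1 ?_
  rw [Complex.ofReal_zero]
  refine hfin.congr fun N => ?_
  congr 1
  funext i
  rw [← inner_conj_symm (u i) g, RCLike.mul_conj]
  exact (Complex.ofReal_pow _ _).symm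

end RankOne

/-! ### The Koopman operator and the implications between the five properties. -/

section Koopman

universe v

variable {X : Type v} [MeasurableSpace X] {μ : Measure X} [IsProbabilityMeasure μ]
  {T : X ≃ᵐ X} {hT : MeasurePreserving T μ μ}

lemma koopman_surjective {μ : Measure X} (hT : MeasurePreserving T μ μ) :
    Function.Surjective (koopman T hT) := fun f => by
  refine ⟨compL2 T.symm (hT.symm T) f, Lp.ext ?_⟩
  have h := hT.quasiMeasurePreserving.ae_eq_comp (compL2_coeFn (hT.symm T) f)
  refine (compL2_coeFn hT _).trans (h.trans ?_)
  exact Eventually.of_forall fun x => by simp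

lemma koopman_const (hT : MeasurePreserving T μ μ) :
    koopman T hT (Lp.const 2 μ 1) = Lp.const 2 μ 1 := rfl

lemma norm_const_one (μ : Measure X) [IsProbabilityMeasure μ] : ‖Lp.const 2 μ (1 : ℂ)‖ = 1 := by
  exact (Lp.norm_const' 2 μ (1 : ℂ) (by simp) (by simp)).trans (by simp)

lemma theta_apply (f : Lp ℂ 2 μ) :
    Theta μ f = inner ℂ (Lp.const 2 μ 1) f • Lp.const 2 μ (1 : ℂ) :=
  Submodule.starProjection_unit_singleton ℂ (norm_const_one μ) f

lemma mem_constants_orthogonal (f : Lp ℂ 2 μ) :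
    f ∈ (constants μ)ᗮ ↔ inner ℂ (Lp.const 2 μ 1) f = 0 :=
  Submodule.mem_orthogonal_singleton_iff_inner_right

lemma koopman_mem_constants_orthogonal (hT : MeasurePreserving T μ μ) {f : Lp ℂ 2 μ}
    (hf : f ∈ (constants μ)ᗮ) : koopman T hT f ∈ (constants μ)ᗮ := by
  rw [mem_constants_orthogonal] at hf ⊢
  rw [← hf]
  nth_rw 1 [← koopman_const hT]
  exact inner_compL2 hT _ _

lemma iterate_koopman_theta (hT : MeasurePreserving T μ μ) (f : Lp ℂ 2 μ) (i : ℕ) :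
    (koopman T hT)^[i] (Theta μ f) = Theta μ f := by
  refine Function.iterate_fixed ?_ i
  rw [theta_apply, map_smul, koopman_const]

/-- With continuous spectrum, the correlations converge in mean square. -/
lemma HasContinuousSpectrum.tendsto_cesaro (h : HasContinuousSpectrum T hT) (f g : Lp ℂ 2 μ) :
    Tendsto (cesaro ℝ fun i => ‖inner ℂ g ((koopman T hT)^[i] f) - inner ℂ g (Theta μ f)‖ ^ 2)
      atTop (𝓝 0) := by
  have h0 : f - Theta μ f ∈ (constants μ)ᗮ := Submodule.sub_starProjection_mem_orthogonal f
  have := tendsto_cesaro_norm_inner_sq hT (koopman_surjective hT) _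
    (Submodule.isClosed_orthogonal (constants μ))
    (fun x hx => koopman_mem_constants_orthogonal hT hx) (fun z x hx hz => h z x hx hz) h0 g
  refine this.congr fun N => ?_
  congr 1
  funext i
  have hsub : (compL2 T hT)^[i] (f - Theta μ f) =
      (compL2 T hT)^[i] f - (compL2 T hT)^[i] (Theta μ f) := iterate_map_sub _ _ _ _
  rw [hsub, inner_sub_right]
  congr 4
  exact iterate_koopman_theta hT f i

lemma inner_indicator_theta {A B : Set X} (hA : MeasurableSet A) (hB : MeasurableSet B) :
    inner ℂ (indicatorConstLp 2 hA (measure_ne_top μ A) (1 : ℂ))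
      (Theta μ (indicatorConstLp 2 hB (measure_ne_top μ B) (1 : ℂ))) =
      ((μ.real A * μ.real B : ℝ) : ℂ) := by
  rw [theta_apply, inner_smul_right, ← indicatorConstLp_univ,
    L2.inner_indicatorConstLp_one_indicatorConstLp_one,
    L2.inner_indicatorConstLp_one_indicatorConstLp_one, Set.univ_inter, Set.inter_univ]
  push_cast
  exact mul_comm _ _

lemma measureReal_iterate_image_inter {μ : Measure X} (hT : MeasurePreserving T μ μ)
    {A B : Set X} (hA : MeasurableSet A) (hB : MeasurableSet B) (i : ℕ) :
    μ.real (T^[i] '' A ∩ B) = μ.real (A ∩ T^[i] ⁻¹' B) := by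
  have hm : MeasurableSet (T^[i] '' A) := by
    induction i with
    | zero => simpa using hA
    | succ i ih =>
      rw [Function.iterate_succ', Set.image_comp]
      exact T.measurableSet_image.2 ih
  rw [← (hT.iterate i).measureReal_preimage (hm.inter hB).nullMeasurableSet, Set.preimage_inter,
    Set.preimage_image_eq _ (T.injective.iterate i)]

/-- Invertibility turns forward images into preimages, and the shift from `1, …, N` to `0, …, N - 1`
is harmless for bounded terms. -/
lemma isAlmostMixing_iff (hT : MeasurePreserving T μ μ) :
    IsAlmostMixing μ T ↔ ∀ A B : Set X, MeasurableSet A → MeasurableSet B →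
      Tendsto (cesaro ℝ fun i => |μ.real (A ∩ T^[i] ⁻¹' B) - μ.real A * μ.real B|)
        atTop (𝓝 0) := by
  refine forall₄_congr fun A B hA hB => ?_
  simp only [one_div_mul_sum_Icc, measureReal_iterate_image_inter hT hA hB]
  refine tendsto_cesaro_succ
    (c := fun i => |μ.real (A ∩ T^[i] ⁻¹' B) - μ.real A * μ.real B|) (M := 1) fun i => ?_
  rw [Real.norm_eq_abs, abs_abs, abs_le]
  have h1 := mul_le_one₀ (measureReal_le_one (μ := μ) (s := A)) measureReal_nonneg
    (measureReal_le_one (μ := μ) (s := B))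
  have h2 := mul_nonneg (measureReal_nonneg (μ := μ) (s := A)) (measureReal_nonneg (μ := μ) (s := B))
  have h3 := measureReal_le_one (μ := μ) (s := A ∩ T^[i] ⁻¹' B)
  have h4 := measureReal_nonneg (μ := μ) (s := A ∩ T^[i] ⁻¹' B)
  constructor <;> linarith

lemma HasContinuousSpectrum.isAlmostMixing (h : HasContinuousSpectrum T hT) :
    IsAlmostMixing μ T := by
  rw [isAlmostMixing_iff hT]
  intro A B hA hB
  refine tendsto_cesaro_abs_of_sq ((h.tendsto_cesaro
    (indicatorConstLp 2 hB (measure_ne_top μ B) (1 : ℂ))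
    (indicatorConstLp 2 hA (measure_ne_top μ A) (1 : ℂ))).congr fun N => ?_)
  congr 1
  funext i
  have := inner_indicator_iterate_compL2 hT hA hB i
  change inner ℂ _ ((koopman T hT)^[i] _) = _ at this
  rw [this, inner_indicator_theta, ← Complex.ofReal_sub, Complex.norm_real, Real.norm_eq_abs,
    sq_abs]

lemma IsAlmostMixing.hasErgodicProducts (hT : MeasurePreserving T μ μ)
    (h : IsAlmostMixing μ T) : HasErgodicProducts μ T := by
  rw [isAlmostMixing_iff hT] at h
  intro Y _ _ ν _ S hS
  refine ergodic_of_tendsto_cesaro (hS.toMeasurePreserving.prod hT) generateFrom_prod.symm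
    isPiSystem_prod ?_
  rintro _ ⟨A, hA, B, hB, rfl⟩ _ ⟨C, hC, D, hD, rfl⟩
  simp only [Prod.map_iterate, Set.preimage_prod_map_prod, Set.prod_inter_prod,
    measureReal_prod_prod]
  rw [show ν.real A * μ.real B * (ν.real C * μ.real D) =
    (ν.real A * ν.real C) * (μ.real B * μ.real D) by ring]
  refine tendsto_cesaro_mul (fun i => ?_) (tendsto_cesaro_of_ergodic hS hA hC) (h B D hB hD)
  rw [abs_of_nonneg measureReal_nonneg]
  exact measureReal_le_one

lemma HasErgodicProducts.ergodic (h : HasErgodicProducts μ T) : Ergodic T μ := by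
  -- The one-point system is ergodic, and its product with `T` has `T` as a factor; `PUnit.{v + 1}`
  -- lives in the universe of `X`.
  have hid : Ergodic (MeasurableEquiv.refl PUnit.{v + 1}) (Measure.dirac PUnit.unit) := by
    refine ⟨.id _, ⟨fun s _ _ => ?_⟩⟩
    rw [eventuallyConst_set']
    rcases Set.eq_empty_or_nonempty s with rfl | hs
    · exact Or.inl (ae_eq_refl _)
    · rw [Subsingleton.eq_univ_of_nonempty hs]
      exact Or.inr (ae_eq_refl _)
  exact measurePreserving_snd.ergodic_of_ergodic_semiconj (h PUnit.{v + 1} _ _ hid) T.measurable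
    fun _ => rfl

lemma norm_eq_one_of_koopman_eq_smul {μ : Measure X} {hT : MeasurePreserving T μ μ} {z : ℂ}
    {f : Lp ℂ 2 μ} (hf : f ≠ 0) (h : koopman T hT f = z • f) : ‖z‖ = 1 := by
  have h1 : ‖koopman T hT f‖ = ‖f‖ := norm_compL2_apply hT f
  rw [h, norm_smul] at h1
  exact (mul_eq_right₀ (norm_ne_zero_iff.2 hf)).1 h1

/-- Since `|z| = 1`, `f ⊗ conj f` is invariant, hence a constant; it is orthogonal to `1` because
`f` is, so it vanishes and `f = 0`. -/
lemma hasContinuousSpectrum_of_ergodic_prod (h : Ergodic (Prod.map T T) (μ.prod μ)) :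
    HasContinuousSpectrum T hT := by
  intro z f hf hz
  by_contra hf0
  have hz1 := norm_eq_one_of_koopman_eq_smul hf0 hz
  have hfix : compL2 (Prod.map T T) (hT.prod hT) (tensor f f) = tensor f f := by
    have hz' : compL2 T hT f = z • f := hz
    rw [compL2_tensor hT, hz']
    refine Lp.ext ?_
    have h1 := (Measure.quasiMeasurePreserving_fst (μ := μ) (ν := μ)).ae_eq_comp
      (Lp.coeFn_smul z f)
    have h2 := (Measure.quasiMeasurePreserving_snd (μ := μ) (ν := μ)).ae_eq_comp
      (Lp.coeFn_smul z f)
    filter_upwards [tensor_coeFn f f, tensor_coeFn (z • f) (z • f), h1, h2] with p a1 a2 a3 a4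
    simp only [Function.comp_apply, Pi.smul_apply, smul_eq_mul] at a3 a4
    have hzz : z * starRingEnd ℂ z = 1 := by rw [Complex.mul_conj']; simp [hz1]
    rw [a1, a2, a3, a4, map_mul]
    linear_combination (f p.1 * starRingEnd ℂ (f p.2)) * hzz
  obtain ⟨c, hc⟩ := exists_ae_eq_const_of_compL2_eq (hT.prod hT) h hfix
  have hF : tensor f f = Lp.const 2 (μ.prod μ) c := Lp.ext (hc.trans (Lp.coeFn_const 2 _ c).symm)
  have hone : tensor (Lp.const 2 μ 1) (Lp.const 2 μ 1) = Lp.const 2 (μ.prod μ) 1 := by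
    refine Lp.ext ?_
    have h1 := (Measure.quasiMeasurePreserving_fst (μ := μ) (ν := μ)).ae_eq_comp
      (Lp.coeFn_const 2 μ (1 : ℂ))
    have h2 := (Measure.quasiMeasurePreserving_snd (μ := μ) (ν := μ)).ae_eq_comp
      (Lp.coeFn_const 2 μ (1 : ℂ))
    filter_upwards [tensor_coeFn (Lp.const 2 μ (1 : ℂ)) (Lp.const 2 μ 1), h1, h2,
      Lp.coeFn_const 2 (μ.prod μ) (1 : ℂ)] with p a1 a2 a3 a4
    simp only [Function.comp_apply, Function.const_apply] at a2 a3 a4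
    rw [a1, a2, a3, a4]
    simp
  have hinner := inner_tensor (Lp.const 2 μ 1) (Lp.const 2 μ 1) f f
  rw [(mem_constants_orthogonal f).1 hf, zero_mul, hone, hF, ← indicatorConstLp_univ,
    ← indicatorConstLp_univ, L2.inner_indicatorConstLp_indicatorConstLp] at hinner
  have hc0 : c = 0 := by simpa using hinner
  have hn := norm_tensor f f
  rw [hF, hc0, map_zero, norm_zero] at hn
  exact hf0 (norm_eq_zero.1 (mul_self_eq_zero.1 hn.symm))

/-- An eigenfunction has `|⟨f, Uⁿf⟩| = ‖f‖²` for all `n`, while weak convergence forces the limit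
`0`. -/
lemma IsWeaklyMixing.hasContinuousSpectrum (h : IsWeaklyMixing T hT) :
    HasContinuousSpectrum T hT := by
  obtain ⟨n, -, hn⟩ := h
  intro z f hf hz
  by_contra hf0
  have hz1 := norm_eq_one_of_koopman_eq_smul hf0 hz
  have hpow : ∀ k : ℕ, (koopman T hT ^ k) f = z ^ k • f := fun k => by
    induction k with
    | zero => simp
    | succ k ih =>
      rw [pow_succ', mul_apply_eq_comp, ih, map_smul, hz, smul_smul, pow_succ]
  have h1 := (hn f f).norm
  rw [theta_apply, (mem_constants_orthogonal f).1 hf, zero_smul, inner_zero_right,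
    norm_zero] at h1
  have h2 : ∀ i, ‖(inner ℂ f ((koopman T hT ^ n i) f) : ℂ)‖ = ‖f‖ ^ 2 := fun i => by
    rw [hpow, inner_smul_right, norm_mul, norm_pow, hz1, one_pow, one_mul,
      inner_self_eq_norm_sq_to_K]
    simp
  simp only [h2] at h1
  have := tendsto_nhds_unique h1 tendsto_const_nhds
  exact hf0 (norm_eq_zero.1 (pow_eq_zero_iff two_ne_zero |>.1 this.symm))

/-- Uniformly Lipschitz functions that tend to zero on a dense set tend to zero everywhere. -/
lemma tendsto_zero_of_dense {E : Type*} [NormedAddCommGroup E] {φ : ℕ → E → ℂ} {C : ℝ}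
    (hφ : ∀ i x y, ‖φ i x - φ i y‖ ≤ C * ‖x - y‖) {s : Set E} (hs : Dense s)
    (h : ∀ x ∈ s, Tendsto (φ · x) atTop (𝓝 0)) (x : E) : Tendsto (φ · x) atTop (𝓝 0) := by
  have hC : 0 < |C| + 1 := by positivity
  rw [Metric.tendsto_atTop]
  intro ε hε
  obtain ⟨y, hys, hy⟩ := Metric.dense_iff.1 hs x (ε / 2 / (|C| + 1)) (by positivity)
  obtain ⟨N, hN⟩ := Metric.tendsto_atTop.1 (h _ hy) (ε / 2) (by positivity)
  refine ⟨N, fun i hi => ?_⟩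
  have h1 := hN i hi
  rw [dist_zero_right] at h1 ⊢
  rw [Metric.mem_ball', dist_eq_norm, lt_div_iff₀ hC] at hys
  have h2 := hφ i x y
  have h3 : C * ‖x - y‖ ≤ ‖x - y‖ * (|C| + 1) := by
    nlinarith [norm_nonneg (x - y), le_abs_self C]
  calc ‖φ i x‖ = ‖(φ i x - φ i y) + φ i y‖ := by rw [sub_add_cancel]
    _ ≤ ‖φ i x - φ i y‖ + ‖φ i y‖ := norm_add_le _ _
    _ < ε := by linarith

lemma HasContinuousSpectrum.isWeaklyMixing [StandardBorelSpace X]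
    (h : HasContinuousSpectrum T hT) : IsWeaklyMixing T hT := by
  have : Fact ((2 : ENNReal) ≠ ⊤) := ⟨by simp⟩
  obtain ⟨d, hd⟩ := TopologicalSpace.exists_dense_seq (Lp ℂ 2 μ)
  let a : ℕ → ℕ → ℕ → ℝ := fun k l n =>
    ‖inner ℂ (d l) ((koopman T hT)^[n] (d k)) - inner ℂ (d l) (Theta μ (d k))‖ ^ 2
  -- Diagonal choice: the time `n i ≥ i` serves all pairs among the first `i` dense vectors, with
  -- total error below `1 / (i + 1)`.
  have hsmall : ∀ i : ℕ, ∃ n, i ≤ n ∧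
      ∑ k ∈ Finset.range i, ∑ l ∈ Finset.range i, a k l n < 1 / ((i : ℝ) + 1) := fun i => by
    refine exists_lt_of_tendsto_cesaro_zero
      (c := fun n => ∑ k ∈ Finset.range i, ∑ l ∈ Finset.range i, a k l n)
      (fun n => Finset.sum_nonneg fun k _ => Finset.sum_nonneg fun l _ => sq_nonneg _)
      ?_ (by positivity) i
    have : Tendsto (fun N => ∑ k ∈ Finset.range i, ∑ l ∈ Finset.range i, cesaro ℝ (a k l) N)
        atTop (𝓝 (∑ k ∈ Finset.range i, ∑ l ∈ Finset.range i, 0)) :=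
      tendsto_finsetSum _ fun k _ => tendsto_finsetSum _ fun l _ => h.tendsto_cesaro (d k) (d l)
    simp only [Finset.sum_const_zero] at this
    refine this.congr fun N => ?_
    rw [cesaro_sum]
    exact Finset.sum_congr rfl fun k _ => (cesaro_sum _ _ _).symm
  choose n hn hlt using hsmall
  refine ⟨n, tendsto_atTop_mono hn tendsto_id, ?_⟩
  let B : ℕ → Lp ℂ 2 μ →L[ℂ] Lp ℂ 2 μ := fun i => koopman T hT ^ n i - Theta μ
  have hB : ∀ i x, ‖B i x‖ ≤ 2 * ‖x‖ := fun i x => by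
    have h1 : ‖(koopman T hT ^ n i) x‖ = ‖x‖ := by
      rw [FunLike.coe_pow_eq_iterate]
      exact norm_iterate_compL2 hT (n i) x
    have h2 : ‖Theta μ x‖ ≤ 1 * ‖x‖ :=
      (Theta μ).le_of_opNorm_le (Submodule.starProjection_norm_le _) x
    calc ‖B i x‖ ≤ ‖(koopman T hT ^ n i) x‖ + ‖Theta μ x‖ := norm_sub_le _ _
      _ ≤ 2 * ‖x‖ := by linarith
  have hdd : ∀ k l, Tendsto (fun i => inner ℂ (d l) (B i (d k))) atTop (𝓝 0) := fun k l => by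
    rw [tendsto_zero_iff_norm_tendsto_zero]
    have hsq : Tendsto (fun i => ‖inner ℂ (d l) (B i (d k))‖ ^ 2) atTop (𝓝 0) := by
      refine squeeze_zero' (Eventually.of_forall fun i => sq_nonneg _) ?_
        tendsto_one_div_add_atTop_nhds_zero_nat
      filter_upwards [eventually_gt_atTop k, eventually_gt_atTop l] with i hk hl
      refine le_trans (le_trans ?_ (Finset.single_le_sum
        (f := fun k => ∑ l ∈ Finset.range i, a k l (n i))
        (fun k _ => Finset.sum_nonneg fun l _ => sq_nonneg _) (Finset.mem_range.2 hk)))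
        (hlt i).le
      refine le_trans (le_of_eq ?_) (Finset.single_le_sum (f := fun l => a k l (n i))
        (fun l _ => sq_nonneg _) (Finset.mem_range.2 hl))
      simp only [B, a, _root_.sub_apply, inner_sub_right, FunLike.coe_pow_eq_iterate]
    simpa using hsq.sqrt
  -- Density extends the limit in one argument at a time, by the uniform bound `‖B i‖ ≤ 2`.
  have hdg : ∀ l x, Tendsto (fun i => inner ℂ (d l) (B i x)) atTop (𝓝 0) := fun l =>
    tendsto_zero_of_dense (φ := fun i x => inner ℂ (d l) (B i x)) (C := ‖d l‖ * 2)
      (fun i x y => by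
        rw [← inner_sub_right, ← map_sub, mul_assoc]
        exact (norm_inner_le_norm _ _).trans (by gcongr; exact hB i _))
      hd (by rintro _ ⟨k, rfl⟩; exact hdd k l)
  intro f g
  have hall := tendsto_zero_of_dense (φ := fun i y => inner ℂ y (B i f)) (C := 2 * ‖f‖)
      (fun i x y => by
        rw [← inner_sub_left, mul_comm]
        exact (norm_inner_le_norm _ _).trans (by gcongr; exact hB i _))
      hd (by rintro _ ⟨l, rfl⟩; exact hdg l f) g
  simp only [B, _root_.sub_apply, inner_sub_right] at hall
  simpa using hall.add_const (inner ℂ g (Theta μ f))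

end Koopman

theorem theorem4p1 {X : Type*} [MeasurableSpace X] [StandardBorelSpace X]
    (μ : Measure X) [IsProbabilityMeasure μ] (T : X ≃ᵐ X) (hT : MeasurePreserving T μ μ) :
    List.TFAE [
      IsWeaklyMixing T hT,
      HasContinuousSpectrum T hT,
      Ergodic (Prod.map T T) (μ.prod μ),
      IsAlmostMixing μ T,
      HasErgodicProducts μ T] := by
  tfae_have 1 → 2 := IsWeaklyMixing.hasContinuousSpectrum
  tfae_have 2 → 1 := HasContinuousSpectrum.isWeaklyMixing
  tfae_have 2 → 4 := HasContinuousSpectrum.isAlmostMixing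
  tfae_have 4 → 5 := IsAlmostMixing.hasErgodicProducts hT
  tfae_have 5 → 3 := fun h => h X μ T h.ergodic
  tfae_have 3 → 2 := hasContinuousSpectrum_of_ergodic_prod
  tfae_finish
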